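/- On $\mathbb{C}^2$ write $D_j=\partial/\partial z_j$, $\bar D_j=\partial/\partial\bar z_j$ for the Wirtinger derivatives and, for multi-indices $\alpha,\beta\in\mathbb{N}^2$, $D^\beta=D_1^{\beta_1}D_2^{\beta_2}$, $\bar D^\alpha=\bar D_1^{\alpha_1}\bar D_2^{\alpha_2}$, $|\alpha|=\alpha_1+\alpha_2$. For integers $p,q\ge 0$ let $H_{p,q}(\mathbb{C}^2)$ be the complex vector space of polynomials in $z,\bar z$ on $\mathbb{C}^2$ that are homogeneous of bidegree $p,q$ (linear combinations of the $z^\alpha\bar z^\beta$ with $|\alpha|=p$, $|\beta|=q$) and harmonic ($\Delta f=0$ with $\Delta=4(D_1\bar D_1+D_2\bar D_2)$), and let $H_{p,q}(\mathbb{S}^3)$ be the space of their restrictions to the unit sphere $\mathbb{S}^3\subset\mathbb{C}^2$. Let $K$ be the Kelvin transform, $Kg(z)=|z|^{-2}g(z/|z|^2)$ for $z\neq 0$. **Theorem.** Let $p,q\ge 0$ be integers. The functions $$K[\bar D^\alpha D^\beta|z|^{-2}],\qquad |\alpha|=p,\ |\beta|=q,\ \alpha_1=0\text{ or }\beta_1=0,$$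 defined on $\mathbb{C}^2\setminus\{0\}$, extend to polynomials on $\mathbb{C}^2$, and (indexed by the pairs $(\alpha,\beta)$) these form a vector space basis of $H_{p,q}(\mathbb{C}^2)$. Their restrictions to $\mathbb{S}^3$ are the functions $\bar D^\alpha D^\beta|z|^{-2}$ with the same $\alpha,\beta$, and these form a basis of $H_{p,q}(\mathbb{S}^3)$ that is orthogonal with respect to the inner product $\langle f,g\rangle=\int_{\mathbb{S}^3}f\bar g\,d\sigma$ of $L^2(\mathbb{S}^3)$, where $\sigma$ is the surface area measure. -/

import Mathlib

open scoped ContDiff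

noncomputable section

namespace SphericalHarmonics

/-- Complex two-space `ℂ²` with its Euclidean (Hermitian) norm. -/
abbrev C2 : Type := EuclideanSpace ℂ (Fin 2)

/-- The unit sphere `𝕊³ ⊆ ℂ²`. -/
abbrev S3 : Set C2 := Metric.sphere (0 : C2) 1

/-- The standard surface area measure on `𝕊³`. -/
def sigma : MeasureTheory.Measure S3 :=
  (MeasureTheory.volume : MeasureTheory.Measure C2).toSphere

/-- The Wirtinger derivative `∂/∂z_j = (∂/∂x_j - i ∂/∂y_j) / 2`, where `z_j = x_j + i y_j`. -/
def dz (j : Fin 2) (f : C2 → ℂ) (z : C2) : ℂ :=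
  (1 / 2 : ℂ) * (fderiv ℝ f z (EuclideanSpace.single j 1)
    - Complex.I * fderiv ℝ f z (EuclideanSpace.single j Complex.I))

/-- The Wirtinger derivative `∂/∂z̄_j = (∂/∂x_j + i ∂/∂y_j) / 2`, where `z_j = x_j + i y_j`. -/
def dzbar (j : Fin 2) (f : C2 → ℂ) (z : C2) : ℂ :=
  (1 / 2 : ℂ) * (fderiv ℝ f z (EuclideanSpace.single j 1)
    + Complex.I * fderiv ℝ f z (EuclideanSpace.single j Complex.I))

/-- `D^β = (∂/∂z_1)^{β_1} (∂/∂z_2)^{β_2}`. -/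
def DPow (β : Fin 2 → ℕ) (f : C2 → ℂ) : C2 → ℂ :=
  (dz 0)^[β 0] ((dz 1)^[β 1] f)

/-- `D̄^α = (∂/∂z̄_1)^{α_1} (∂/∂z̄_2)^{α_2}`. -/
def DbarPow (α : Fin 2 → ℕ) (f : C2 → ℂ) : C2 → ℂ :=
  (dzbar 0)^[α 0] ((dzbar 1)^[α 1] f)

/-- The Laplacian `Δ = 4 (∂²/∂z_1∂z̄_1 + ∂²/∂z_2∂z̄_2)` on `ℂ²`. -/
def laplacian (f : C2 → ℂ) (z : C2) : ℂ :=
  4 * (dz 0 (dzbar 0 f) z + dz 1 (dzbar 1 f) z)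

/-- The Kelvin transform `K g (z) = |z|⁻² g (z / |z|²)` (meaningful for `z ≠ 0`). -/
def kelvin (g : C2 → ℂ) (z : C2) : ℂ :=
  (((‖z‖ ^ 2)⁻¹ : ℝ) : ℂ) * g ((‖z‖ ^ 2)⁻¹ • z)

/-- The function `|z|⁻²` (meaningful for `z ≠ 0`). -/
def invNormSq (z : C2) : ℂ := (((‖z‖ ^ 2)⁻¹ : ℝ) : ℂ)

/-- The monomial function `z^α z̄^β`. -/
def monomialFun (α β : Fin 2 → ℕ) (z : C2) : ℂ :=
  (∏ j, z j ^ α j) * ∏ j, (starRingEnd ℂ (z j)) ^ β j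

/-- `P_{p,q}(ℂ²)`: the polynomial functions on `ℂ²` that are homogeneous of bidegree `p, q`,
that is, of degree `p` in `z` and of degree `q` in `z̄`. -/
def Ppq (p q : ℕ) : Submodule ℂ (C2 → ℂ) :=
  Submodule.span ℂ {f | ∃ α β : Fin 2 → ℕ, ∑ j, α j = p ∧ ∑ j, β j = q ∧ f = monomialFun α β}

theorem contDiff_of_mem_Ppq {p q : ℕ} {f : C2 → ℂ} (hf : f ∈ Ppq p q) : ContDiff ℝ ∞ f := by
  unfold Ppq at hf
  induction hf using Submodule.span_induction with
  | mem f h =>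
    obtain ⟨α, β, -, -, rfl⟩ := h
    have hc (j : Fin 2) : ContDiff ℝ ∞ (fun z : C2 => z j) := by fun_prop
    have hcb (j : Fin 2) : ContDiff ℝ ∞ (fun z : C2 => (starRingEnd ℂ) (z j)) :=
      Complex.conjCLE.contDiff.comp (hc j)
    unfold monomialFun
    exact (contDiff_prod fun j _ => (hc j).pow _).mul (contDiff_prod fun j _ => (hcb j).pow _)
  | zero => exact contDiff_const
  | add f g _ _ hf hg => exact hf.add hg
  | smul c f _ hf => exact contDiff_const.smul hf

theorem contDiff_dzbar (j : Fin 2) {f : C2 → ℂ} (hf : ContDiff ℝ ∞ f) :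
    ContDiff ℝ ∞ (dzbar j f) := by
  have h (v : C2) : ContDiff ℝ ∞ (fun z => fderiv ℝ f z v) :=
    (hf.fderiv_right (m := ∞) (by simp)).clm_apply contDiff_const
  unfold dzbar
  exact contDiff_const.mul ((h _).add (contDiff_const.mul (h _)))

theorem dz_add (j : Fin 2) {f g : C2 → ℂ} (hf : Differentiable ℝ f) (hg : Differentiable ℝ g) :
    dz j (f + g) = dz j f + dz j g := by
  funext z
  simp only [dz, fderiv_add (hf z) (hg z), Pi.add_apply, add_apply]
  ring

theorem dzbar_add (j : Fin 2) {f g : C2 → ℂ} (hf : Differentiable ℝ f)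
    (hg : Differentiable ℝ g) : dzbar j (f + g) = dzbar j f + dzbar j g := by
  funext z
  simp only [dzbar, fderiv_add (hf z) (hg z), Pi.add_apply, add_apply]
  ring

theorem dz_smul (j : Fin 2) (c : ℂ) {f : C2 → ℂ} (hf : Differentiable ℝ f) :
    dz j (c • f) = c • dz j f := by
  funext z
  simp only [dz, fderiv_const_smul (hf z) c, Pi.smul_apply, smul_apply,
    smul_eq_mul]
  ring

theorem dzbar_smul (j : Fin 2) (c : ℂ) {f : C2 → ℂ} (hf : Differentiable ℝ f) :
    dzbar j (c • f) = c • dzbar j f := by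
  funext z
  simp only [dzbar, fderiv_const_smul (hf z) c, Pi.smul_apply, smul_apply,
    smul_eq_mul]
  ring

theorem laplacian_add {f g : C2 → ℂ} (hf : ContDiff ℝ ∞ f) (hg : ContDiff ℝ ∞ g) :
    laplacian (f + g) = laplacian f + laplacian g := by
  have d {h : C2 → ℂ} (hh : ContDiff ℝ ∞ h) : Differentiable ℝ h := hh.differentiable (by simp)
  funext z
  simp only [laplacian, Pi.add_apply, dzbar_add _ (d hf) (d hg),
    dz_add _ (d (contDiff_dzbar _ hf)) (d (contDiff_dzbar _ hg))]
  ring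

theorem laplacian_smul (c : ℂ) {f : C2 → ℂ} (hf : ContDiff ℝ ∞ f) :
    laplacian (c • f) = c • laplacian f := by
  have d {h : C2 → ℂ} (hh : ContDiff ℝ ∞ h) : Differentiable ℝ h := hh.differentiable (by simp)
  funext z
  simp only [laplacian, Pi.smul_apply, dzbar_smul _ c (d hf),
    dz_smul _ c (d (contDiff_dzbar _ hf)), smul_eq_mul]
  ring

/-- `H_{p,q}(ℂ²)`: the harmonic polynomials on `ℂ²` that are homogeneous of bidegree `p, q`. -/
def Hpq (p q : ℕ) : Submodule ℂ (C2 → ℂ) where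
  carrier := {f | f ∈ Ppq p q ∧ laplacian f = 0}
  zero_mem' := by
    refine ⟨Submodule.zero_mem _, ?_⟩
    have h := laplacian_smul 0 (f := (0 : C2 → ℂ)) contDiff_const
    simpa using h
  add_mem' := by
    rintro f g ⟨hf, hf'⟩ ⟨hg, hg'⟩
    refine ⟨Submodule.add_mem _ hf hg, ?_⟩
    rw [laplacian_add (contDiff_of_mem_Ppq hf) (contDiff_of_mem_Ppq hg), hf', hg', add_zero]
  smul_mem' := by
    rintro c f ⟨hf, hf'⟩
    refine ⟨Submodule.smul_mem _ c hf, ?_⟩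
    rw [laplacian_smul c (contDiff_of_mem_Ppq hf), hf', smul_zero]

/-- `H_{p,q}(𝕊³)`: the restrictions to `𝕊³` of the elements of `H_{p,q}(ℂ²)`. -/
def HpqS (p q : ℕ) : Submodule ℂ (S3 → ℂ) :=
  (Hpq p q).map (LinearMap.funLeft ℂ ℂ (Subtype.val : S3 → C2))

/-- The index set: pairs `(α, β)` of multi-indices with `|α| = p`, `|β| = q`, and
`α_1 = 0` or `β_1 = 0`. -/
def Index (p q : ℕ) : Type :=
  {ab : (Fin 2 → ℕ) × (Fin 2 → ℕ) //
    ∑ j, ab.1 j = p ∧ ∑ j, ab.2 j = q ∧ (ab.1 0 = 0 ∨ ab.2 0 = 0)}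

/-- The function `D̄^α D^β |z|⁻²` (meaningful for `z ≠ 0`) for the index `(α, β)`. -/
def derivInvNormSq {p q : ℕ} (i : Index p q) : C2 → ℂ :=
  DbarPow i.1.1 (DPow i.1.2 invNormSq)

end SphericalHarmonics

end

/-! Differentiating `P / |z|^(2c)` gives `(|z|² ∂_s P - c z̄_s P) / |z|^(2c+2)`, where `z̄_s` is the
conjugate of the variable `s`, so the numerators of the iterated derivatives of `|z|⁻²` satisfy a
recursion in the ring of polynomials in `z, z̄`. By Euler's identity the recursion preserves
harmonicity; it also keeps the numerators homogeneous for the bidegree and for the weight under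
rotations of `z₁`. By homogeneity the numerators are the Kelvin transforms.

Harmonicity expresses the coefficient at a monomial divisible by `z₁ z̄₁` through coefficients with
a smaller exponent of `z₁`, so a harmonic polynomial is determined by its coefficients at the other
monomials. Among those of bidegree `(p, q)`, each weight under rotations of `z₁` occurs at most
once, and they are indexed by the same pairs `(α, β)` as the Kelvin transforms. Hence these
coefficients are, up to scalars, dual to the Kelvin transforms; the scalars are nonzero because a
Kelvin transform with zero coefficient at its own monomial would vanish identically, whereas the
recursion shows that it does not vanish on the complexified null cone `|z|² = 0`.

Distinct weights under the measure-preserving rotations of `z₁` also give orthogonality on `𝕊³`. -/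

noncomputable section

namespace SphericalHarmonics

open MvPolynomial MeasureTheory Topology

section Polynomials

variable {σ R M : Type*}

theorem pderiv_pderiv_comm [CommRing R] (s t : σ) (P : MvPolynomial σ R) :
    pderiv s (pderiv t P) = pderiv t (pderiv s P) := by
  classical
  have hbracket : ⁅(pderiv s : Derivation R (MvPolynomial σ R) _), pderiv t⁆ = 0 :=
    derivation_ext fun u => by
      rw [Derivation.commutator_apply]
      simp [pderiv_X, Pi.single_apply, apply_ite]
  exact sub_eq_zero.1 ((Derivation.commutator_apply _).symm.trans (DFunLike.congr_fun hbracket P))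

theorem eq_zero_of_constantCoeff_eq_zero_of_pderiv [CommSemiring R] [CharZero R]
    [NoZeroDivisors R] {p : MvPolynomial σ R → Prop} (hpderiv : ∀ P s, p P → p (pderiv s P))
    (hconst : ∀ P, p P → constantCoeff P = 0) {P : MvPolynomial σ R} (hP : p P) : P = 0 := by
  ext m
  induction m using WellFoundedLT.induction generalizing P with
  | ind m ih =>
    obtain rfl | hm := eq_or_ne m 0
    · exact hconst P hP
    obtain ⟨s, hs⟩ := Finsupp.ne_iff.1 hm
    have hle : Finsupp.single s 1 ≤ m :=
      Finsupp.single_le_iff.2 (Nat.one_le_iff_ne_zero.2 hs)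
    have hlt : m - Finsupp.single s 1 < m :=
      lt_of_le_of_ne tsub_le_self fun h => (Nat.sub_one_lt hs).ne (by simpa using congr($h s))
    have hderiv := ih _ hlt (hpderiv P s hP)
    rw [coeff_pderiv, tsub_add_cancel_of_le hle, coeff_zero, mul_eq_zero] at hderiv
    exact hderiv.resolve_right (Nat.cast_add_one_ne_zero _)

theorem sum_X_mul_pderiv_pderiv [Fintype σ] [CommRing R] {P : MvPolynomial σ R} {n : ℕ}
    (hP : P.IsHomogeneous n) (s : σ) :
    ∑ t, X t * pderiv t (pderiv s P) = (n - 1 : R) • pderiv s P := by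
  rw [hP.pderiv.sum_X_mul_pderiv]
  cases n with
  | zero =>
    rw [← totalDegree_zero_iff_isHomogeneous, totalDegree_eq_zero_iff_eq_C] at hP
    rw [hP, pderiv_C, smul_zero, smul_zero]
  | succ n => simp [← Nat.cast_smul_eq_nsmul R]

theorem eval_character_mul [CommSemiring R] [AddCommMonoid M] {w : σ → M} {n : M}
    {P : MvPolynomial σ R} (hP : P.IsWeightedHomogeneous w n)
    (χ : Multiplicative M →* R) (x : σ → R) :
    eval (fun s => χ (.ofAdd (w s)) * x s) P = χ (.ofAdd n) * eval x P := by
  simp only [eval_eq, Finset.mul_sum]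
  refine Finset.sum_congr rfl fun m hm => ?_
  have hweight : ∏ s ∈ m.support, χ (.ofAdd (w s)) ^ m s = χ (.ofAdd n) := by
    rw [← hP (mem_support_iff.1 hm), Finsupp.weight_apply, Finsupp.sum, ofAdd_sum, map_prod]
    simp only [ofAdd_nsmul, map_pow]
  simp only [mul_pow, Finset.prod_mul_distrib, hweight]
  ring

end Polynomials

section Weights

variable {ι R : Type*}

/-- The weights recording the degree in `z` and the degree in `z̄`. Here and below, polynomials in
`z, z̄` are polynomials in independent variables: `Sum.inl j` for `z_j`, `Sum.inr j` for `z̄_j`. -/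
def bidegree : ι ⊕ ι → ℕ × ℕ := Sum.elim (fun _ => (1, 0)) fun _ => (0, 1)

/-- The weights of the variables under the rotations `z_j ↦ u z_j`, `|u| = 1`. -/
def rotationWeight [DecidableEq ι] (j : ι) : ι ⊕ ι → ℤ :=
  Sum.elim (Pi.single j 1) (Pi.single j (-1))

theorem weight_bidegree [Fintype ι] (m : ι ⊕ ι →₀ ℕ) :
    Finsupp.weight bidegree m = (∑ j, m (.inl j), ∑ j, m (.inr j)) := by
  simp [Finsupp.weight_eq_sum, bidegree, Prod.ext_iff, Prod.fst_sum, Prod.snd_sum]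

theorem weight_rotationWeight [DecidableEq ι] (j : ι) (m : ι ⊕ ι →₀ ℕ) :
    Finsupp.weight (rotationWeight j) m = m (.inl j) - m (.inr j) := by
  induction m using Finsupp.induction_linear with
  | zero => simp
  | add m m' hm hm' =>
    simp only [map_add, hm, hm', Finsupp.add_apply]
    push_cast
    ring
  | single s n =>
    rcases s with k | k <;> obtain rfl | hk := eq_or_ne k j <;>
      simp [Finsupp.weight_single, rotationWeight, *]

theorem isHomogeneous_of_isWeightedHomogeneous_bidegree [CommSemiring R] {p q : ℕ}
    {P : MvPolynomial (ι ⊕ ι) R} (hP : P.IsWeightedHomogeneous bidegree (p, q)) :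
    P.IsHomogeneous (p + q) := by
  have hsum (m : ι ⊕ ι →₀ ℕ) :
      Finsupp.weight 1 m = (Finsupp.weight bidegree m).1 + (Finsupp.weight bidegree m).2 := by
    induction m using Finsupp.induction_linear with
    | zero => simp
    | add m m' hm hm' =>
      simp only [map_add, hm, hm', Prod.fst_add, Prod.snd_add]
      ring
    | single s n => rcases s with j | j <;> simp [Finsupp.weight_single, bidegree]
  intro m hm
  rw [hsum, hP hm]

end Weights

section ConjugateVariables

variable {ι R : Type*} [Fintype ι] [CommRing R]

variable (ι R) in
/-- The polynomial `∑ z_j z̄_j` representing `|z|²`. -/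
def normSqPoly : MvPolynomial (ι ⊕ ι) R := ∑ j, X (.inl j) * X (.inr j)

/-- The operator `∑ ∂²/∂z_j∂z̄_j`, a quarter of the Laplacian, on polynomials in `z, z̄`. -/
def quarterLaplacian : MvPolynomial (ι ⊕ ι) R →ₗ[R] MvPolynomial (ι ⊕ ι) R :=
  ∑ j, (pderiv (.inl j)).toLinearMap ∘ₗ (pderiv (.inr j)).toLinearMap

theorem quarterLaplacian_apply (P : MvPolynomial (ι ⊕ ι) R) :
    quarterLaplacian P = ∑ j, pderiv (.inl j) (pderiv (.inr j) P) := by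
  simp [quarterLaplacian]

theorem pderiv_normSqPoly (s : ι ⊕ ι) : pderiv s (normSqPoly ι R) = X s.swap := by
  classical
  rcases s with j | j <;> simp [normSqPoly, pderiv_X, Pi.single_apply]

theorem quarterLaplacian_mul (P Q : MvPolynomial (ι ⊕ ι) R) :
    quarterLaplacian (P * Q) = quarterLaplacian P * Q + P * quarterLaplacian Q
      + ∑ s, pderiv s P * pderiv s.swap Q := by
  simp only [quarterLaplacian_apply, pderiv_mul, map_add, Finset.sum_add_distrib,
    Fintype.sum_sum_type, Finset.sum_mul, Finset.mul_sum, Sum.swap_inl, Sum.swap_inr]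
  ring

theorem quarterLaplacian_pderiv (s : ι ⊕ ι) (P : MvPolynomial (ι ⊕ ι) R) :
    quarterLaplacian (pderiv s P) = pderiv s (quarterLaplacian P) := by
  simp only [quarterLaplacian_apply, map_sum, pderiv_pderiv_comm s]

theorem quarterLaplacian_X_mul (s : ι ⊕ ι) (P : MvPolynomial (ι ⊕ ι) R) :
    quarterLaplacian (X s * P) = X s * quarterLaplacian P + pderiv s.swap P := by
  classical
  have hX : quarterLaplacian (X s : MvPolynomial (ι ⊕ ι) R) = 0 := by
    simp [quarterLaplacian_apply, pderiv_X, Pi.single_apply, apply_ite]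
  rw [quarterLaplacian_mul, hX, zero_mul, zero_add]
  simp [pderiv_X, Pi.single_apply]

theorem quarterLaplacian_normSqPoly_mul (P : MvPolynomial (ι ⊕ ι) R) :
    quarterLaplacian (normSqPoly ι R * P) = (Fintype.card ι : R) • P
      + normSqPoly ι R * quarterLaplacian P + ∑ s, X s * pderiv s P := by
  have hnorm : quarterLaplacian (normSqPoly ι R) = C (Fintype.card ι : R) := by
    simp [quarterLaplacian_apply, pderiv_normSqPoly]
  have hcross : ∑ s, pderiv s (normSqPoly ι R) * pderiv s.swap P = ∑ s, X s * pderiv s P := by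
    simp only [pderiv_normSqPoly]
    exact (Equiv.sumComm ι ι).sum_comp fun s => X s * pderiv s P
  rw [quarterLaplacian_mul, hnorm, hcross, smul_eq_C_mul]

/-- The numerator of the derivative `∂_s (P / |z|^(2c)) = (kelvinStep c s P) / |z|^(2c+2)`. -/
def kelvinStep (c : R) (s : ι ⊕ ι) (P : MvPolynomial (ι ⊕ ι) R) : MvPolynomial (ι ⊕ ι) R :=
  normSqPoly ι R * pderiv s P - c • (X s.swap * P)

theorem quarterLaplacian_kelvinStep {n : ℕ} {P : MvPolynomial (ι ⊕ ι) R} (hP : P.IsHomogeneous n)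
    (hharm : quarterLaplacian P = 0) (s : ι ⊕ ι) :
    quarterLaplacian (kelvinStep (n + Fintype.card ι - 1 : R) s P) = 0 := by
  rw [kelvinStep, map_sub, map_smul, quarterLaplacian_normSqPoly_mul, quarterLaplacian_X_mul,
    quarterLaplacian_pderiv, hharm, sum_X_mul_pderiv_pderiv hP, Sum.swap_swap]
  simp only [map_zero, mul_zero, zero_add, add_zero]
  module

theorem isWeightedHomogeneous_kelvinStep {M : Type*} [AddCancelCommMonoid M] {w : ι ⊕ ι → M}
    {κ n : M} (hw : ∀ s, w s + w s.swap = κ) {P : MvPolynomial (ι ⊕ ι) R}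
    (hP : P.IsWeightedHomogeneous w n) (c : R) (s : ι ⊕ ι) :
    (kelvinStep c s P).IsWeightedHomogeneous w (w s.swap + n) := by
  have hnorm : (normSqPoly ι R).IsWeightedHomogeneous w κ :=
    IsWeightedHomogeneous.sum _ _ _ fun j _ =>
      hw (.inl j) ▸ (isWeightedHomogeneous_X R w _).mul (isWeightedHomogeneous_X R w _)
  have hX := (isWeightedHomogeneous_X R w s.swap).mul hP
  rw [kelvinStep, smul_eq_C_mul]
  refine IsWeightedHomogeneous.sub ?_ (hX.C_mul c)
  by_cases hd : ∃ m, coeff m (pderiv s P) ≠ 0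
  · obtain ⟨m, hm⟩ := hd
    rw [coeff_pderiv] at hm
    have hn : Finsupp.weight w m + w s = n := by
      rw [← hP (left_ne_zero_of_mul hm), map_add, Finsupp.weight_single, one_smul]
    have hshift : κ + Finsupp.weight w m = w s.swap + n := by rw [← hw s, ← hn]; abel
    exact hshift ▸ hnorm.mul (hP.pderiv hn)
  · rw [(by ext m; simpa using not_exists_not.1 hd m : pderiv s P = 0), mul_zero]
    exact isWeightedHomogeneous_zero R w _

/-- The numerator of an iterated derivative of the fundamental solution: for `d = card ι`,
`∂_l |z|^(2-2d) = (kelvinNumerator R l) / |z|^(2 (length l + d - 1))`. -/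
def kelvinNumerator (R : Type*) [CommRing R] : List (ι ⊕ ι) → MvPolynomial (ι ⊕ ι) R
  | [] => 1
  | s :: l => kelvinStep (l.length + Fintype.card ι - 1 : R) s (kelvinNumerator R l)

theorem isWeightedHomogeneous_kelvinNumerator {M : Type*} [AddCancelCommMonoid M] {w : ι ⊕ ι → M}
    {κ : M} (hw : ∀ s, w s + w s.swap = κ) (l : List (ι ⊕ ι)) :
    (kelvinNumerator R l).IsWeightedHomogeneous w (l.map fun s => w s.swap).sum := by
  induction l with
  | nil => exact isWeightedHomogeneous_one R w
  | cons s l ih => exact isWeightedHomogeneous_kelvinStep hw ih _ s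

theorem isHomogeneous_kelvinNumerator (l : List (ι ⊕ ι)) :
    (kelvinNumerator R l).IsHomogeneous l.length := by
  rw [IsHomogeneous]
  simpa using isWeightedHomogeneous_kelvinNumerator (R := R) (w := (1 : ι ⊕ ι → ℕ))
    (κ := 2) (fun _ => rfl) l

theorem quarterLaplacian_kelvinNumerator (l : List (ι ⊕ ι)) :
    quarterLaplacian (kelvinNumerator R l) = 0 := by
  induction l with
  | nil => simp [kelvinNumerator, quarterLaplacian_apply]
  | cons s l ih => exact quarterLaplacian_kelvinStep (isHomogeneous_kelvinNumerator l) ih s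

-- At a point of the null cone `|z|² = 0`, only the terms `c z̄_s P` of the recursion survive.
theorem eval_kelvinNumerator_ne_zero [CharZero R] [NoZeroDivisors R] [Nontrivial ι]
    {x : ι ⊕ ι → R} (hnull : eval x (normSqPoly ι R) = 0) (hx : ∀ s, x s ≠ 0)
    (l : List (ι ⊕ ι)) : eval x (kelvinNumerator R l) ≠ 0 := by
  induction l with
  | nil => simp [kelvinNumerator]
  | cons s l ih =>
    have hcard : (l.length + Fintype.card ι - 1 : R) ≠ 0 := by
      have := Fintype.one_lt_card (α := ι)
      rw [sub_ne_zero]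
      norm_cast
      omega
    simpa [kelvinNumerator, kelvinStep, hnull, hx] using ⟨hcard, ih⟩

theorem eq_zero_of_quarterLaplacian_eq_zero [CharZero R] [NoZeroDivisors R] (j₀ : ι)
    {P : MvPolynomial (ι ⊕ ι) R} (hharm : quarterLaplacian P = 0)
    (hP : ∀ m, m (.inl j₀) = 0 ∨ m (.inr j₀) = 0 → coeff m P = 0) : P = 0 := by
  classical
  ext m
  induction hk : m (.inl j₀) generalizing m with
  | zero => exact hP m (.inl hk)
  | succ k ih =>
    by_cases hr : m (.inr j₀) = 0
    · exact hP m (.inr hr)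
    obtain ⟨m', rfl⟩ : ∃ m', m = m' + .single (.inl j₀) 1 + .single (.inr j₀) 1 := by
      refine ⟨m - .single (.inl j₀) 1 - .single (.inr j₀) 1, ?_⟩
      ext s
      simp only [Finsupp.add_apply, Finsupp.tsub_apply, Finsupp.single_apply]
      grind
    have hcoeff := congrArg (coeff m') hharm
    simp only [quarterLaplacian_apply, coeff_sum, coeff_pderiv, coeff_zero] at hcoeff
    rw [Finset.sum_eq_single j₀ (fun j _ hj => ?_) (by simp)] at hcoeff
    · simpa [Nat.cast_add_one_ne_zero] using hcoeff
    · rw [ih _ (by simpa [hj] using hk)]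
      simp

variable (ι R) in
/-- The harmonic polynomials in `z, z̄` that are homogeneous of bidegree `p, q`. -/
def harmonicPoly (p q : ℕ) : Submodule R (MvPolynomial (ι ⊕ ι) R) :=
  weightedHomogeneousSubmodule R bidegree (p, q) ⊓ LinearMap.ker quarterLaplacian

end ConjugateVariables

section WirtingerCalculus

variable {s : Fin 2 ⊕ Fin 2} {f g : C2 → ℂ} {z : C2}

/-- The values `z_j`, `z̄_j` of the variables at a point of `ℂ²`. -/
def coord : Fin 2 ⊕ Fin 2 → C2 → ℂ :=
  Sum.elim (fun j z => z j) fun j z => starRingEnd ℂ (z j)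

/-- The function on `ℂ²` given by a polynomial in `z, z̄`. -/
def evalConj : MvPolynomial (Fin 2 ⊕ Fin 2) ℂ →ₐ[ℂ] C2 → ℂ := aeval coord

theorem evalConj_apply (P : MvPolynomial (Fin 2 ⊕ Fin 2) ℂ) (z : C2) :
    evalConj P z = eval (coord · z) P :=
  DFunLike.congr_fun (comp_aeval coord (Pi.evalAlgHom ℂ (fun _ : C2 => ℂ) z)) P

theorem evalConj_X (s : Fin 2 ⊕ Fin 2) : evalConj (X s) = coord s := aeval_X coord s

theorem evalConj_C (c : ℂ) : evalConj (C c) = fun _ => c := aeval_C coord c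

theorem evalConj_normSqPoly (z : C2) : evalConj (normSqPoly (Fin 2) ℂ) z = (‖z‖ : ℂ) ^ 2 := by
  rw [← Complex.ofReal_pow, EuclideanSpace.norm_sq_eq]
  simp [evalConj_apply, normSqPoly, coord, Complex.mul_conj, Complex.normSq_eq_norm_sq]

theorem evalConj_normSqPoly_ne_zero (hz : z ≠ 0) : evalConj (normSqPoly (Fin 2) ℂ) z ≠ 0 := by
  simpa [evalConj_normSqPoly] using hz

theorem differentiable_coord (s : Fin 2 ⊕ Fin 2) : Differentiable ℝ (coord s) := by
  rcases s with j | j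
  · exact (by fun_prop : Differentiable ℝ fun z : C2 => z j)
  · exact Complex.conjCLE.differentiable.comp (by fun_prop : Differentiable ℝ fun z : C2 => z j)

theorem differentiable_evalConj (P : MvPolynomial (Fin 2 ⊕ Fin 2) ℂ) :
    Differentiable ℝ (evalConj P) := by
  induction P using MvPolynomial.induction_on with
  | C c => exact evalConj_C c ▸ differentiable_const c
  | add P Q hP hQ => exact map_add evalConj P Q ▸ hP.add hQ
  | mul_X P s hP =>
    rw [map_mul, evalConj_X]
    exact hP.mul (differentiable_coord s)

/-- The Wirtinger derivatives `∂/∂z_j` and `∂/∂z̄_j`, indexed like the variables. -/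
def wirtinger : Fin 2 ⊕ Fin 2 → (C2 → ℂ) → C2 → ℂ := Sum.elim dz dzbar

theorem wirtinger_congr (h : f =ᶠ[𝓝 z] g) : wirtinger s f z = wirtinger s g z := by
  rcases s with j | j <;> simp only [wirtinger, Sum.elim_inl, Sum.elim_inr, dz, dzbar, h.fderiv_eq]

theorem wirtinger_const (c : ℂ) : wirtinger s (fun _ => c) = 0 := by
  ext z
  rcases s with j | j <;> simp [wirtinger, dz, dzbar]

theorem wirtinger_add (hf : Differentiable ℝ f) (hg : Differentiable ℝ g) :
    wirtinger s (f + g) = wirtinger s f + wirtinger s g := by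
  rcases s with j | j
  · exact dz_add j hf hg
  · exact dzbar_add j hf hg

theorem wirtinger_mul (hf : DifferentiableAt ℝ f z) (hg : DifferentiableAt ℝ g z) :
    wirtinger s (f * g) z = f z * wirtinger s g z + g z * wirtinger s f z := by
  rcases s with j | j <;>
    simp only [wirtinger, Sum.elim_inl, Sum.elim_inr, dz, dzbar, fderiv_mul hf hg, add_apply,
      smul_apply, smul_eq_mul] <;>
    ring

theorem wirtinger_comp {φ : ℂ → ℂ} {φ' : ℂ} (hφ : HasDerivAt φ φ' (f z))
    (hf : DifferentiableAt ℝ f z) : wirtinger s (φ ∘ f) z = φ' * wirtinger s f z := by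
  have hfderiv := (hφ.complexToReal_fderiv.comp z hf.hasFDerivAt).fderiv
  rcases s with j | j <;>
    simp only [wirtinger, Sum.elim_inl, Sum.elim_inr, dz, dzbar, hfderiv,
      ContinuousLinearMap.comp_apply, smul_apply, one_apply_eq_self, smul_eq_mul] <;>
    ring

theorem wirtinger_coord (s t : Fin 2 ⊕ Fin 2) (z : C2) :
    wirtinger s (coord t) z = (Pi.single s 1 : Fin 2 ⊕ Fin 2 → ℂ) t := by
  have hz (j : Fin 2) (v : C2) : fderiv ℝ (coord (.inl j)) z v = v j :=
    congr($(((EuclideanSpace.proj j : C2 →L[ℂ] ℂ).restrictScalars ℝ).fderiv) v)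
  have hzbar (j : Fin 2) (v : C2) : fderiv ℝ (coord (.inr j)) z v = starRingEnd ℂ (v j) :=
    congr($((Complex.conjCLE.toContinuousLinearMap ∘L
      (EuclideanSpace.proj j : C2 →L[ℂ] ℂ).restrictScalars ℝ).fderiv) v)
  rcases s with j | j <;> rcases t with k | k <;> obtain rfl | hjk := eq_or_ne k j <;>
    simp [wirtinger, dz, dzbar, one_add_one_eq_two, *]

theorem wirtinger_evalConj (s : Fin 2 ⊕ Fin 2) (P : MvPolynomial (Fin 2 ⊕ Fin 2) ℂ) :
    wirtinger s (evalConj P) = evalConj (pderiv s P) := by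
  induction P using MvPolynomial.induction_on with
  | C c => rw [evalConj_C, wirtinger_const, pderiv_C, map_zero]
  | add P Q hP hQ =>
    rw [map_add, map_add, map_add, wirtinger_add (differentiable_evalConj P)
      (differentiable_evalConj Q), hP, hQ]
  | mul_X P t hP =>
    ext z
    rw [map_mul, wirtinger_mul (differentiable_evalConj P z) (differentiable_evalConj _ z), hP,
      evalConj_X, wirtinger_coord, pderiv_mul, pderiv_X, map_add, map_mul, map_mul, evalConj_X]
    obtain rfl | hst := eq_or_ne t s <;> simp [*, mul_comm, add_comm]

theorem laplacian_evalConj (P : MvPolynomial (Fin 2 ⊕ Fin 2) ℂ) :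
    laplacian (evalConj P) = (4 : ℂ) • evalConj (quarterLaplacian P) := by
  have hz (j : Fin 2) Q : dz j (evalConj Q) = _ := wirtinger_evalConj (.inl j) Q
  have hzbar (j : Fin 2) Q : dzbar j (evalConj Q) = _ := wirtinger_evalConj (.inr j) Q
  ext z
  simp [laplacian, hz, hzbar, quarterLaplacian_apply]

-- The Taylor coefficients at the origin of `P` are recovered by Wirtinger derivatives.
theorem evalConj_injective : Function.Injective evalConj := by
  refine (injective_iff_map_eq_zero _).2 fun P hP =>
    eq_zero_of_constantCoeff_eq_zero_of_pderiv (p := (evalConj · = 0)) (fun P s hP => ?_)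
      (fun P hP => ?_) hP
  · rw [← wirtinger_evalConj, hP]
    exact wirtinger_const 0
  · have hcoord : (coord · 0) = 0 := by ext s; rcases s with _ | _ <;> simp [coord]
    rw [← eval_zero, ← hcoord, ← evalConj_apply, hP, Pi.zero_apply]

theorem wirtinger_div_normSq_pow (s : Fin 2 ⊕ Fin 2) (n : ℕ)
    (P : MvPolynomial (Fin 2 ⊕ Fin 2) ℂ) (hz : z ≠ 0) :
    wirtinger s (fun z => evalConj P z / evalConj (normSqPoly (Fin 2) ℂ) z ^ (n + 1)) z =
      evalConj (kelvinStep (n + 1 : ℂ) s P) z / evalConj (normSqPoly (Fin 2) ℂ) z ^ (n + 2) := by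
  have hr := evalConj_normSqPoly_ne_zero hz
  have hpow := (hasDerivAt_pow (n + 1) (evalConj (normSqPoly (Fin 2) ℂ) z)).inv (pow_ne_zero _ hr)
  have hnorm := differentiable_evalConj (normSqPoly (Fin 2) ℂ) z
  have hmul := wirtinger_mul (s := s) (differentiable_evalConj P z)
    (hpow.complexToReal_fderiv.comp z hnorm.hasFDerivAt).differentiableAt
  rw [wirtinger_comp hpow hnorm, wirtinger_evalConj, wirtinger_evalConj, pderiv_normSqPoly] at hmul
  refine hmul.trans ?_
  simp only [kelvinStep, map_sub, map_mul, map_smul, Pi.sub_apply, Pi.mul_apply, Pi.smul_apply,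
    smul_eq_mul, Function.comp_apply, Pi.inv_apply, Nat.add_sub_cancel, Nat.cast_add_one]
  field_simp
  ring

theorem foldr_wirtinger_invNormSq (l : List (Fin 2 ⊕ Fin 2)) (hz : z ≠ 0) :
    l.foldr wirtinger invNormSq z =
      evalConj (kelvinNumerator ℂ l) z / evalConj (normSqPoly (Fin 2) ℂ) z ^ (l.length + 1) := by
  induction l generalizing z with
  | nil => simp [invNormSq, kelvinNumerator, evalConj_normSqPoly]
  | cons s l ih =>
    have hnear : l.foldr wirtinger invNormSq =ᶠ[𝓝 z] fun z =>
        evalConj (kelvinNumerator ℂ l) z / evalConj (normSqPoly (Fin 2) ℂ) z ^ (l.length + 1) := by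
      filter_upwards [isOpen_ne.mem_nhds hz] with w hw using ih hw
    have hexp : (l.length + Fintype.card (Fin 2) - 1 : ℂ) = l.length + 1 := by
      rw [Fintype.card_fin]
      push_cast
      ring
    rw [List.foldr_cons, wirtinger_congr hnear, wirtinger_div_normSq_pow s _ _ hz, kelvinNumerator,
      hexp, List.length_cons]

theorem evalConj_smul {P : MvPolynomial (Fin 2 ⊕ Fin 2) ℂ} {n : ℕ} (hP : P.IsHomogeneous n)
    (t : ℝ) (z : C2) : evalConj P (t • z) = (t : ℂ) ^ n * evalConj P z := by
  have hcoord : (coord · (t • z)) = fun s => (t : ℂ) * coord s z := by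
    ext s
    rcases s with j | j <;> simp [coord]
  rw [evalConj_apply, evalConj_apply, hcoord]
  simpa using eval_character_mul hP (powersHom ℂ (t : ℂ)) (coord · z)

theorem kelvin_foldr_wirtinger_invNormSq (l : List (Fin 2 ⊕ Fin 2)) (hz : z ≠ 0) :
    kelvin (l.foldr wirtinger invNormSq) z = evalConj (kelvinNumerator ℂ l) z := by
  have hnorm : (‖z‖ : ℂ) ≠ 0 := by simpa using hz
  rw [kelvin, foldr_wirtinger_invNormSq l (smul_ne_zero (by simpa using hz) hz),
    evalConj_smul (isHomogeneous_kelvinNumerator l), evalConj_normSqPoly, norm_smul]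
  simp only [Complex.ofReal_inv, Complex.ofReal_pow, Complex.ofReal_mul, inv_pow, norm_inv,
    norm_pow, norm_norm, mul_pow]
  field_simp
  ring

end WirtingerCalculus

section HarmonicPolynomials

variable {p q : ℕ}

theorem evalConj_monomial (m : Fin 2 ⊕ Fin 2 →₀ ℕ) (c : ℂ) :
    evalConj (monomial m c) = c • monomialFun (fun j => m (.inl j)) fun j => m (.inr j) := by
  ext z
  simp [evalConj_apply, eval_monomial, Finsupp.prod_fintype, monomialFun, coord]

theorem map_evalConj_weightedHomogeneousSubmodule (p q : ℕ) :
    (weightedHomogeneousSubmodule ℂ bidegree (p, q)).map evalConj.toLinearMap = Ppq p q := by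
  apply le_antisymm
  · rintro _ ⟨P, hP, rfl⟩
    rw [P.as_sum, map_sum]
    refine Submodule.sum_mem _ fun m hm => ?_
    have hdeg := hP (mem_support_iff.1 hm)
    rw [weight_bidegree, Prod.mk.injEq] at hdeg
    rw [AlgHom.toLinearMap_apply, evalConj_monomial]
    exact Submodule.smul_mem _ _ (Submodule.subset_span ⟨_, _, hdeg.1, hdeg.2, rfl⟩)
  · refine Submodule.span_le.2 ?_
    rintro _ ⟨α, β, hα, hβ, rfl⟩
    refine ⟨monomial (Finsupp.equivFunOnFinite.symm (Sum.elim α β)) 1,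
      isWeightedHomogeneous_monomial _ _ _ ?_, ?_⟩
    · simpa [weight_bidegree] using And.intro hα hβ
    · rw [AlgHom.toLinearMap_apply, evalConj_monomial, one_smul]
      rfl

theorem map_evalConj_harmonicPoly (p q : ℕ) :
    (harmonicPoly (Fin 2) ℂ p q).map evalConj.toLinearMap = Hpq p q := by
  ext f
  constructor
  · rintro ⟨P, ⟨hP, hharm⟩, rfl⟩
    refine ⟨map_evalConj_weightedHomogeneousSubmodule p q ▸ Submodule.mem_map_of_mem hP, ?_⟩
    rw [AlgHom.toLinearMap_apply, laplacian_evalConj, LinearMap.mem_ker.1 hharm, map_zero,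
      smul_zero]
  · rintro ⟨hf, hharm⟩
    obtain ⟨P, hP, rfl⟩ := (map_evalConj_weightedHomogeneousSubmodule p q).symm ▸ hf
    rw [AlgHom.toLinearMap_apply, laplacian_evalConj, smul_eq_zero_iff_right (by norm_num),
      map_eq_zero_iff _ evalConj_injective] at hharm
    exact ⟨P, ⟨hP, hharm⟩, rfl⟩

/-- The identification of harmonic polynomials in `z, z̄` with harmonic polynomial functions. -/
def harmonicPolyEquiv (p q : ℕ) : harmonicPoly (Fin 2) ℂ p q ≃ₗ[ℂ] Hpq p q :=
  (Submodule.equivMapOfInjective evalConj.toLinearMap evalConj_injective _).trans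
    (LinearEquiv.ofEq _ _ (map_evalConj_harmonicPoly p q))

theorem evalConj_eq_zero_of_sphere {P : MvPolynomial (Fin 2 ⊕ Fin 2) ℂ} {n : ℕ}
    (hP : P.IsHomogeneous n) (h0 : ∀ z : S3, evalConj P z = 0) : evalConj P = 0 := by
  have hray (u : S3) (t : ℝ) : evalConj P (t • (u : C2)) = 0 := by
    rw [evalConj_smul hP, h0, mul_zero]
  funext z
  obtain rfl | hz := eq_or_ne z 0
  · simpa using hray ⟨EuclideanSpace.single 0 1, by simp⟩ 0
  · have hpolar := hray ⟨(‖z‖⁻¹ : ℝ) • z, by simp [norm_smul, hz]⟩ ‖z‖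
    rwa [smul_inv_smul₀ (norm_ne_zero_iff.2 hz)] at hpolar

/-- Restriction to the sphere, as an isomorphism of `H_{p,q}(ℂ²)` onto `H_{p,q}(𝕊³)`. -/
def restrictEquiv (p q : ℕ) : Hpq p q ≃ₗ[ℂ] HpqS p q :=
  LinearEquiv.ofBijective ((LinearMap.funLeft ℂ ℂ (Subtype.val : S3 → C2)).submoduleMap (Hpq p q))
    ⟨(injective_iff_map_eq_zero _).2 fun f hf => by
      obtain ⟨P, rfl⟩ := (harmonicPolyEquiv p q).surjective f
      have hP := isHomogeneous_of_isWeightedHomogeneous_bidegree P.2.1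
      exact Subtype.ext (evalConj_eq_zero_of_sphere hP fun z => congr(($hf : S3 → ℂ) z)),
    LinearMap.submoduleMap_surjective _ _⟩

end HarmonicPolynomials

section KelvinBasis

variable {p q : ℕ}

instance (p q : ℕ) : Finite (Index p q) :=
  (Finset.finite_toSet (Finset.univ.piAntidiag p ×ˢ Finset.univ.piAntidiag q)).subset
    fun αβ (h : _ ∧ _ ∧ _) => by simp [h.1, h.2.1]

/-- The derivatives making up `D̄^α D^β`, in the order of composition. -/
def derivWord (α β : Fin 2 → ℕ) : List (Fin 2 ⊕ Fin 2) :=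
  .replicate (α 0) (.inr 0) ++ .replicate (α 1) (.inr 1) ++
    (.replicate (β 0) (.inl 0) ++ .replicate (β 1) (.inl 1))

theorem foldr_replicate {α β : Type*} (f : α → β → β) (n : ℕ) (a : α) (b : β) :
    (List.replicate n a).foldr f b = (f a)^[n] b := by
  induction n with
  | zero => rfl
  | succ n ih => rw [List.replicate_succ, List.foldr_cons, ih, Function.iterate_succ_apply']

theorem foldr_derivWord (α β : Fin 2 → ℕ) (f : C2 → ℂ) :
    (derivWord α β).foldr wirtinger f = DbarPow α (DPow β f) := by
  simp only [derivWord, List.foldr_append, foldr_replicate]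
  rfl

theorem sum_map_derivWord {M : Type*} [AddCommMonoid M] (w : Fin 2 ⊕ Fin 2 → M)
    (α β : Fin 2 → ℕ) :
    ((derivWord α β).map w).sum = ∑ j, α j • w (.inr j) + ∑ j, β j • w (.inl j) := by
  simp [derivWord, add_assoc]

/-- The polynomial extending `K[D̄^α D^β |z|⁻²]` to the origin. -/
def kelvinPoly (i : Index p q) : MvPolynomial (Fin 2 ⊕ Fin 2) ℂ :=
  kelvinNumerator ℂ (derivWord i.1.1 i.1.2)

theorem kelvin_derivInvNormSq (i : Index p q) {z : C2} (hz : z ≠ 0) :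
    kelvin (derivInvNormSq i) z = evalConj (kelvinPoly i) z := by
  rw [derivInvNormSq, ← foldr_derivWord, kelvin_foldr_wirtinger_invNormSq _ hz, kelvinPoly]

theorem kelvin_eq_on_sphere (g : C2 → ℂ) (z : S3) : kelvin g z = g z := by
  simp [kelvin, mem_sphere_zero_iff_norm.1 z.2]

theorem kelvinPoly_mem_harmonicPoly (i : Index p q) :
    kelvinPoly i ∈ harmonicPoly (Fin 2) ℂ p q := by
  refine ⟨?_, quarterLaplacian_kelvinNumerator _⟩
  have hbal (s : Fin 2 ⊕ Fin 2) : bidegree s + bidegree s.swap = (1, 1) := by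
    rcases s with j | j <;> rfl
  have hword : ((derivWord i.1.1 i.1.2).map fun s => bidegree s.swap).sum = (p, q) := by
    simpa [sum_map_derivWord, bidegree] using And.intro i.2.1 i.2.2.1
  exact hword ▸ isWeightedHomogeneous_kelvinNumerator hbal _

/-- The weight of `K[D̄^α D^β |z|⁻²]` under rotations of the first coordinate. -/
def Index.weight (i : Index p q) : ℤ := i.1.1 0 - i.1.2 0

theorem Index.weight_injective : Function.Injective (Index.weight : Index p q → ℤ) := by
  rintro ⟨⟨α, β⟩, hα, hβ, h⟩ ⟨⟨γ, δ⟩, hγ, hδ, h'⟩ hw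
  simp only [Index.weight, Fin.sum_univ_two] at hα hβ h hγ hδ h' hw
  refine Subtype.ext (Prod.ext (funext fun k => ?_) (funext fun k => ?_)) <;>
    fin_cases k <;> simp only [Fin.zero_eta, Fin.mk_one] <;> omega

theorem isWeightedHomogeneous_rotationWeight_kelvinPoly (i : Index p q) :
    (kelvinPoly i).IsWeightedHomogeneous (rotationWeight 0) i.weight := by
  have hbal (s : Fin 2 ⊕ Fin 2) : rotationWeight 0 s + rotationWeight 0 s.swap = 0 := by
    decide +revert
  have hword : ((derivWord i.1.1 i.1.2).map fun s => rotationWeight 0 s.swap).sum = i.weight := by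
    simp [sum_map_derivWord, rotationWeight, Index.weight, sub_eq_add_neg]
  exact hword ▸ isWeightedHomogeneous_kelvinNumerator hbal _

/-- The exponent of the monomial `z^α z̄^β`. -/
def exponent (i : Index p q) : Fin 2 ⊕ Fin 2 →₀ ℕ :=
  Finsupp.equivFunOnFinite.symm (Sum.elim i.1.1 i.1.2)

theorem exists_exponent_eq {m : Fin 2 ⊕ Fin 2 →₀ ℕ} (hm : Finsupp.weight bidegree m = (p, q))
    (h0 : m (.inl 0) = 0 ∨ m (.inr 0) = 0) : ∃ i : Index p q, exponent i = m := by
  rw [weight_bidegree, Prod.mk.injEq] at hm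
  refine ⟨⟨(fun j => m (.inl j), fun j => m (.inr j)), hm.1, hm.2, h0⟩, ?_⟩
  ext s
  rcases s with j | j <;> rfl

theorem eq_zero_of_coeff_exponent_eq_zero {P : MvPolynomial (Fin 2 ⊕ Fin 2) ℂ}
    (hP : P ∈ harmonicPoly (Fin 2) ℂ p q) (hcoeff : ∀ i : Index p q, coeff (exponent i) P = 0) :
    P = 0 := by
  refine eq_zero_of_quarterLaplacian_eq_zero 0 hP.2 fun m hm => by_contra fun hne => ?_
  obtain ⟨i, rfl⟩ := exists_exponent_eq (hP.1 hne) hm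
  exact hne (hcoeff i)

theorem coeff_exponent_kelvinPoly_of_ne {i j : Index p q} (hij : i ≠ j) :
    coeff (exponent i) (kelvinPoly j) = 0 := by
  refine (isWeightedHomogeneous_rotationWeight_kelvinPoly j).coeff_eq_zero _ ?_
  rw [weight_rotationWeight]
  exact Index.weight_injective.ne hij

theorem coeff_exponent_kelvinPoly_ne_zero (i : Index p q) :
    coeff (exponent i) (kelvinPoly i) ≠ 0 := by
  intro hi
  let nullPoint : Fin 2 ⊕ Fin 2 → ℂ := Sum.elim ![1, 1] ![1, -1]
  have hnull : eval nullPoint (normSqPoly (Fin 2) ℂ) = 0 := by simp [nullPoint, normSqPoly]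
  have hne (s) : nullPoint s ≠ 0 := by rcases s with j | j <;> fin_cases j <;> simp [nullPoint]
  refine eval_kelvinNumerator_ne_zero hnull hne (derivWord i.1.1 i.1.2) ?_
  have hzero : kelvinPoly i = 0 :=
    eq_zero_of_coeff_exponent_eq_zero (kelvinPoly_mem_harmonicPoly i) fun j => by
      obtain rfl | hij := eq_or_ne j i
      exacts [hi, coeff_exponent_kelvinPoly_of_ne hij]
  rw [← kelvinPoly, hzero, map_zero]

theorem dualBases_kelvinPoly (p q : ℕ) :
    Module.DualBases
      (fun i : Index p q => (⟨kelvinPoly i, kelvinPoly_mem_harmonicPoly i⟩ : harmonicPoly _ _ p q))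
      (fun i => (coeff (exponent i) (kelvinPoly i))⁻¹ •
        lcoeff ℂ (exponent i) ∘ₗ (harmonicPoly (Fin 2) ℂ p q).subtype) where
  eval_same i := inv_mul_cancel₀ (coeff_exponent_kelvinPoly_ne_zero i)
  eval_of_ne i j hij := by simp [coeff_exponent_kelvinPoly_of_ne hij]
  total {P Q} hPQ := by
    refine sub_eq_zero.1 (Subtype.ext (eq_zero_of_coeff_exponent_eq_zero (P - Q).2 fun i => ?_))
    simpa [coeff_exponent_kelvinPoly_ne_zero, sub_eq_zero] using hPQ i

/-- The basis of `H_{p,q}(ℂ²)` formed by the extensions of the `K[D̄^α D^β |z|⁻²]`. -/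
def kelvinBasis (p q : ℕ) : Module.Basis (Index p q) ℂ (Hpq p q) :=
  (dualBases_kelvinPoly p q).basis.map (harmonicPolyEquiv p q)

theorem coe_kelvinBasis (i : Index p q) :
    (kelvinBasis p q i : C2 → ℂ) = evalConj (kelvinPoly i) := by
  rw [kelvinBasis, Module.Basis.map_apply, Module.DualBases.coe_basis]
  rfl

/-- The basis of `H_{p,q}(𝕊³)` formed by the restrictions of `kelvinBasis`. -/
def sphereBasis (p q : ℕ) : Module.Basis (Index p q) ℂ (HpqS p q) :=
  (kelvinBasis p q).map (restrictEquiv p q)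

theorem sphereBasis_apply (i : Index p q) (z : S3) :
    (sphereBasis p q i : S3 → ℂ) z = evalConj (kelvinPoly i) z := by
  rw [← coe_kelvinBasis, sphereBasis, Module.Basis.map_apply]
  rfl

end KelvinBasis

section SphereIntegrals

open scoped Pointwise

theorem integral_eq_zero_of_comp_eq_smul {α 𝕜 E : Type*} [MeasurableSpace α] {μ : Measure α}
    [RCLike 𝕜] [NormedAddCommGroup E] [NormedSpace ℝ E] [NormedSpace 𝕜 E] {e : α ≃ᵐ α}
    (he : MeasurePreserving e μ μ) {f : α → E} {c : 𝕜} (hc : c ≠ 1)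
    (hf : ∀ x, f (e x) = c • f x) : ∫ x, f x ∂μ = 0 := by
  have hint := he.integral_comp' f
  simp only [hf, integral_smul] at hint
  have hsub : (c - 1) • ∫ x, f x ∂μ = 0 := by rw [sub_smul, hint, one_smul, sub_self]
  exact (smul_eq_zero.1 hsub).resolve_left (sub_ne_zero.2 hc)

section Isometries

variable {E : Type*} [NormedAddCommGroup E] [NormedSpace ℝ E] [MeasurableSpace E] [BorelSpace E]

/-- A linear isometry as a measurable self-equivalence of the unit sphere. -/
def sphereEquiv (U : E ≃ₗᵢ[ℝ] E) : Metric.sphere (0 : E) 1 ≃ᵐ Metric.sphere (0 : E) 1 :=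
  (U.toHomeomorph.sets (by ext z; simp)).toMeasurableEquiv

theorem coe_sphereEquiv (U : E ≃ₗᵢ[ℝ] E) (z : Metric.sphere (0 : E) 1) :
    (sphereEquiv U z : E) = U z := rfl

theorem measurePreserving_sphereEquiv {U : E ≃ₗᵢ[ℝ] E} {μ : Measure E}
    (hU : MeasurePreserving U μ μ) :
    MeasurePreserving (sphereEquiv U) μ.toSphere μ.toSphere := by
  refine ⟨(sphereEquiv U).measurable, Measure.ext fun s hs => ?_⟩
  have hcone : U ⁻¹' (Set.Ioo (0 : ℝ) 1 • (Subtype.val '' s)) =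
      Set.Ioo (0 : ℝ) 1 • (Subtype.val '' (sphereEquiv U ⁻¹' s)) := by
    ext z
    simp only [Set.mem_smul, Set.mem_image, Set.mem_preimage]
    constructor
    · rintro ⟨t, ht, -, ⟨x, hx, rfl⟩, hz⟩
      refine ⟨t, ht, _, ⟨(sphereEquiv U).symm x, by simpa using hx, rfl⟩, U.injective ?_⟩
      rw [map_smul, ← coe_sphereEquiv, MeasurableEquiv.apply_symm_apply, hz]
    · rintro ⟨t, ht, -, ⟨x, hx, rfl⟩, rfl⟩
      exact ⟨t, ht, _, ⟨sphereEquiv U x, hx, rfl⟩, by rw [map_smul, coe_sphereEquiv]⟩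
  rw [Measure.map_apply (sphereEquiv U).measurable hs, Measure.toSphere_apply' _ hs,
    Measure.toSphere_apply' _ ((sphereEquiv U).measurable hs), ← hcone,
    hU.measure_preimage_emb U.toHomeomorph.measurableEmbedding]

end Isometries

/-- The rotation `z_j ↦ u z_j` of one coordinate of `ℂ²`. -/
def rotate (j : Fin 2) (u : Circle) : C2 ≃ₗᵢ[ℝ] C2 :=
  LinearIsometryEquiv.piLpCongrRight 2 fun k => rotation (Pi.mulSingle (M := fun _ => Circle) j u k)

theorem coord_rotate (j : Fin 2) (u : Circle) (z : C2) (s : Fin 2 ⊕ Fin 2) :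
    coord s (rotate j u z) = (u ^ rotationWeight j s : Circle) * coord s z := by
  rcases s with k | k <;> obtain rfl | hk := eq_or_ne k j <;>
    simp [coord, rotate, rotationWeight, ← Circle.coe_inv_eq_conj, *]

variable {P Q : MvPolynomial (Fin 2 ⊕ Fin 2) ℂ} {j : Fin 2} {k l : ℤ}

theorem evalConj_rotate (hP : P.IsWeightedHomogeneous (rotationWeight j) k) (u : Circle) (z : C2) :
    evalConj P (rotate j u z) = (u ^ k : Circle) * evalConj P z := by
  simp only [evalConj_apply, coord_rotate]
  exact eval_character_mul hP (Circle.coeHom.comp (zpowersHom Circle u)) (coord · z)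

theorem exists_circle_zpow_ne_one (hk : k ≠ 0) : ∃ u : Circle, u ^ k ≠ 1 := by
  refine ⟨.exp (Real.pi / k), ?_⟩
  rw [← Circle.exp_intCast_mul, mul_div_cancel₀ _ (Int.cast_ne_zero.2 hk)]
  exact Circle.exp_pi_ne_one

theorem integral_evalConj_mul_conj_eq_zero (hP : P.IsWeightedHomogeneous (rotationWeight j) k)
    (hQ : Q.IsWeightedHomogeneous (rotationWeight j) l) (hkl : k ≠ l) :
    ∫ z : S3, evalConj P z * starRingEnd ℂ (evalConj Q z) ∂sigma = 0 := by
  obtain ⟨u, hu⟩ := exists_circle_zpow_ne_one (sub_ne_zero.2 hkl)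
  have hrotate : MeasurePreserving (sphereEquiv (rotate j u)) sigma sigma :=
    measurePreserving_sphereEquiv (rotate j u).measurePreserving
  refine integral_eq_zero_of_comp_eq_smul hrotate (c := ((u ^ (k - l) : Circle) : ℂ))
    (Circle.coe_eq_one.not.2 hu) fun z => ?_
  rw [coe_sphereEquiv, evalConj_rotate hP, evalConj_rotate hQ, map_mul, ← Circle.coe_inv_eq_conj,
    zpow_sub, Circle.coe_mul, smul_eq_mul]
  ring

instance : IsFiniteMeasure sigma := inferInstanceAs (IsFiniteMeasure (volume.toSphere))

theorem memLp_evalConj (P : MvPolynomial (Fin 2 ⊕ Fin 2) ℂ) (r : ENNReal) :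
    MemLp (fun z : S3 => evalConj P z) r sigma :=
  ((differentiable_evalConj P).continuous.comp continuous_subtype_val).memLp_of_hasCompactSupport
    (HasCompactSupport.of_compactSpace _)

end SphereIntegrals

end SphericalHarmonics

end

theorem mainTheorem10 (p q : ℕ) :
    -- the functions `K[D̄^α D^β |z|⁻²]` (on `z ≠ 0`) are, after extension over the origin,
    -- a basis of `H_{p,q}(ℂ²)`
    (∃ b : Module.Basis (SphericalHarmonics.Index p q) ℂ (SphericalHarmonics.Hpq p q),
      ∀ (i : SphericalHarmonics.Index p q) (z : SphericalHarmonics.C2), z ≠ 0 →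
        (b i : SphericalHarmonics.C2 → ℂ) z
          = SphericalHarmonics.kelvin (SphericalHarmonics.derivInvNormSq i) z) ∧
    -- their restrictions to the sphere are the functions `D̄^α D^β |z|⁻²`
    (∀ (i : SphericalHarmonics.Index p q) (z : SphericalHarmonics.S3),
      SphericalHarmonics.kelvin (SphericalHarmonics.derivInvNormSq i) z
        = SphericalHarmonics.derivInvNormSq i z) ∧
    -- which form a basis of `H_{p,q}(𝕊³)`, orthogonal in `L²(𝕊³)`
    (∃ c : Module.Basis (SphericalHarmonics.Index p q) ℂ (SphericalHarmonics.HpqS p q),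
      (∀ (i : SphericalHarmonics.Index p q) (z : SphericalHarmonics.S3),
        (c i : SphericalHarmonics.S3 → ℂ) z = SphericalHarmonics.derivInvNormSq i z) ∧
      (∀ i : SphericalHarmonics.Index p q,
        MeasureTheory.MemLp (c i : SphericalHarmonics.S3 → ℂ) 2 SphericalHarmonics.sigma) ∧
      (∀ i j : SphericalHarmonics.Index p q, i ≠ j →
        ∫ z, (c i : SphericalHarmonics.S3 → ℂ) z
          * starRingEnd ℂ ((c j : SphericalHarmonics.S3 → ℂ) z) ∂SphericalHarmonics.sigma = 0)) := by
  open SphericalHarmonics in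
  refine ⟨⟨kelvinBasis p q, fun i z hz => ?_⟩, fun i => kelvin_eq_on_sphere _,
    sphereBasis p q, fun i z => ?_, fun i => ?_, fun i j hij => ?_⟩
  · rw [coe_kelvinBasis, kelvin_derivInvNormSq i hz]
  · rw [sphereBasis_apply, ← kelvin_derivInvNormSq i (ne_zero_of_mem_unit_sphere z),
      kelvin_eq_on_sphere]
  · simpa only [← sphereBasis_apply] using memLp_evalConj (kelvinPoly i) 2
  · simp only [sphereBasis_apply]
    exact integral_evalConj_mul_conj_eq_zero
      (isWeightedHomogeneous_rotationWeight_kelvinPoly i)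
      (isWeightedHomogeneous_rotationWeight_kelvinPoly j) (Index.weight_injective.ne hij)
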